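/- For every real $d$ with $0<d<1$ there exist $\varepsilon>0$ and $C>0$, depending only on $d$, such that the following holds. Let $G$ be a graph and let $U,V$ be disjoint finite sets of vertices of $G$ with $|V|=n$, $3n/4\le |U|\le n$ and $|U|+|V|\equiv 0 \pmod 3$. Suppose that $(U,V)$ is an $(\varepsilon,d)$-super-regular pair in $G$, i.e. $e(X,Y)\ge d\,|X||Y|$ for all non-empty $X\subseteq U$, $Y\subseteq V$ with $|X|\ge\varepsilon|U|$ and $|Y|\ge\varepsilon|V|$, every vertex of $U$ has at least $d|V|$ neighbours in $V$, and every vertex of $V$ has at least $d|U|$ neighbours in $U$. Let $G(U,p)$ and $G(V,p)$ be independent binomial random graphs on the vertex sets $U$ and $V$ with edge probability $p$, where $C/n\le p\le 1$. Then a.a.s. as $n\to\infty$ the graph induced by $G\cup G(U,p)\cup G(V,p)$ on $U\cup V$ contains a triangle-factor, i.e. $(|U|+|V|)/3$ pairwise vertex-disjoint triangles. Here a.a.s. is meant uniformly: for every $\eta>0$ there is an $N$ (depending only on $d$ and $\eta$, once $\varepsilon$ and $C$ are fixed) such that for all $n\ge N$ and all $G,U,V,p$ as above this happens with probability at least $1-\eta$.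 -/

import Mathlib

universe u

/-- The pair `(A, B)` of vertex sets is `(ε, d)`-super-regular in `G`: all `X ⊆ A`, `Y ⊆ B` with
`|X| ≥ ε |A|` and `|Y| ≥ ε |B|` satisfy `d(X, Y) = e(X, Y) / (|X| |Y|) ≥ d`, every vertex of `A`
has at least `d |B|` neighbours in `B`, and every vertex of `B` has at least `d |A|` neighbours
in `A`. -/
structure IsSuperRegularPair {α : Type u} (G : SimpleGraph α) [DecidableRel G.Adj]
    (A B : Finset α) (ε d : ℝ) : Prop where
  density : ∀ X Y : Finset α, X ⊆ A → Y ⊆ B →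
    ε * (A.card : ℝ) ≤ (X.card : ℝ) → ε * (B.card : ℝ) ≤ (Y.card : ℝ) →
      d ≤ ((G.edgeDensity X Y : ℚ) : ℝ)
  degree_left : ∀ a ∈ A, d * (B.card : ℝ) ≤ ((B.filter fun b => G.Adj a b).card : ℝ)
  degree_right : ∀ b ∈ B, d * (A.card : ℝ) ≤ ((A.filter fun a => G.Adj b a).card : ℝ)

/-- `G[S]` contains a triangle-factor: there are `⌊|S| / 3⌋` pairwise vertex-disjoint triangles of
`G` with all their vertices in `S`. -/
def HasTriangleFactorOn {α : Type u} (G : SimpleGraph α) (S : Finset α) : Prop :=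
  ∃ T : Finset (Finset α),
    (∀ t ∈ T, t ⊆ S ∧ G.IsNClique 3 t) ∧
    (T : Set (Finset α)).PairwiseDisjoint id ∧
    T.card = S.card / 3

/-- The graph `G` together with the edges of a graph `H₁` on the vertex set `U` and of a graph `H₂`
on the vertex set `V`. -/
def perturbedGraph {α : Type u} (G : SimpleGraph α) {U V : Finset α}
    (H₁ : SimpleGraph U) (H₂ : SimpleGraph V) : SimpleGraph α :=
  G ⊔ H₁.map (Function.Embedding.subtype (· ∈ U)) ⊔ H₂.map (Function.Embedding.subtype (· ∈ V))

/-! Take x triangles with an edge in U and apex in V, and y of the opposite type, where 2x + y = |U|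
and x + 2y = |V|. If a matching in U is to be completed to triangles by a set of apices in V, one
needs a perfect matching in the auxiliary bipartite graph joining an edge e to v when v is adjacent
in G to both ends of e.

The randomness enters only through `IsRich`: linear-sized sets span a random edge, and for every
large Y only few random edges have fewer than d²|Y| common neighbours in Y. Super-regularity leaves
at most 2ε|A|² pairs with too few common neighbours, so with ε small compared with 1/C it is
exponentially unlikely that linearly many of them become edges. A union bound over at most 2^n sets
Y finishes (`binomialRandom_real_not_isRich_le`).

The rest is deterministic (`hasTriangleTiling_of_isRich`). Greedy matchings slightly larger than
needed are built on both sides. The few vertices with small auxiliary degree are covered greedily,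
which uses the minimum degree condition. The matchings are then trimmed to the exact sizes,
discarding touched and atypical edges, and Hall's condition holds by richness
(`exists_perfect_matching_of_expansion`). -/

/-! ### Triangle tilings and matchings -/

/-- A perfect tiling of the vertex set `S` by triangles of `P`. -/
def HasTriangleTiling {α : Type u} (P : SimpleGraph α) (S : Finset α) : Prop :=
  ∃ T : Finset (Finset α),
    (∀ t ∈ T, t ⊆ S ∧ P.IsNClique 3 t) ∧
    (T : Set (Finset α)).PairwiseDisjoint id ∧
    3 * T.card = S.card

theorem HasTriangleTiling.hasTriangleFactorOn {α : Type u} {P : SimpleGraph α} {S : Finset α}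
    (h : HasTriangleTiling P S) : HasTriangleFactorOn P S := by
  obtain ⟨T, h1, h2, h3⟩ := h
  exact ⟨T, h1, h2, by omega⟩

theorem HasTriangleTiling.empty {α : Type u} (P : SimpleGraph α) :
    HasTriangleTiling P (∅ : Finset α) :=
  ⟨∅, by simp, by simp, by simp⟩

theorem HasTriangleTiling.union {α : Type u} [DecidableEq α] {P : SimpleGraph α} {S S' : Finset α}
    (h : HasTriangleTiling P S) (h' : HasTriangleTiling P S') (hd : Disjoint S S') :
    HasTriangleTiling P (S ∪ S') := by
  obtain ⟨T, h1, h2, h3⟩ := h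
  obtain ⟨T', h1', h2', h3'⟩ := h'
  have key : ∀ t ∈ T, ∀ t' ∈ T', Disjoint t t' := fun t ht t' ht' =>
    Finset.disjoint_of_subset_left (h1 t ht).1 (Finset.disjoint_of_subset_right (h1' t' ht').1 hd)
  have hTT : Disjoint T T' := by
    rw [Finset.disjoint_left]
    intro t ht ht'
    have h4 := key t ht t ht'
    rw [disjoint_self] at h4
    have h5 := (h1 t ht).2.card_eq
    simp [h4] at h5
  refine ⟨T ∪ T', ?_, ?_, ?_⟩
  · intro t ht
    rcases Finset.mem_union.1 ht with ht | ht
    · exact ⟨(h1 t ht).1.trans Finset.subset_union_left, (h1 t ht).2⟩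
    · exact ⟨(h1' t ht).1.trans Finset.subset_union_right, (h1' t ht).2⟩
  · intro s hs t ht hst
    simp only [Finset.coe_union, Set.mem_union, Finset.mem_coe] at hs ht
    rcases hs with hs | hs <;> rcases ht with ht | ht
    · exact h2 hs ht hst
    · exact key s hs t ht
    · exact (key t ht s hs).symm
    · exact h2' hs ht hst
  · rw [Finset.card_union_of_disjoint hTT, Finset.card_union_of_disjoint hd]
    omega

theorem HasTriangleTiling.biUnion {α : Type u} {ι : Type*} [DecidableEq α] [DecidableEq ι]
    {P : SimpleGraph α} (I : Finset ι) (f : ι → Finset α)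
    (hf : ∀ i ∈ I, HasTriangleTiling P (f i))
    (hd : ∀ i ∈ I, ∀ j ∈ I, i ≠ j → Disjoint (f i) (f j)) :
    HasTriangleTiling P (I.biUnion f) := by
  induction I using Finset.induction_on with
  | empty => simpa using HasTriangleTiling.empty P
  | insert i I hi ih =>
    rw [Finset.biUnion_insert]
    refine (hf i (Finset.mem_insert_self _ _)).union (ih (fun j hj => hf j ?_)
      (fun j hj k hk => hd j ?_ k ?_)) ?_
    · exact Finset.mem_insert_of_mem hj
    · exact Finset.mem_insert_of_mem hj
    · exact Finset.mem_insert_of_mem hk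
    · rw [Finset.disjoint_biUnion_right]
      intro j hj
      exact hd i (Finset.mem_insert_self _ _) j (Finset.mem_insert_of_mem hj)
        (fun h => hi (h ▸ hj))

theorem hasTriangleTiling_insert {α : Type u} [DecidableEq α] {P : SimpleGraph α}
    {v : α} {e : Finset α} (he : P.IsNClique 2 e) (hv : ∀ a ∈ e, P.Adj v a) :
    HasTriangleTiling P (insert v e) := by
  have h3 : P.IsNClique 3 (insert v e) := he.insert hv
  exact ⟨{insert v e}, by simpa using h3, by simp, by simp [h3.card_eq]⟩

/-- A matching of the graph `Γ` inside `S`, given as a set of disjoint two-element sets. -/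
structure IsMatchingIn {α : Type u} (Γ : SimpleGraph α) (S : Finset α) (M : Finset (Finset α)) :
    Prop where
  subset : ∀ e ∈ M, e ⊆ S
  clique : ∀ e ∈ M, Γ.IsNClique 2 e
  disjoint : ∀ e ∈ M, ∀ f ∈ M, e ≠ f → Disjoint e f

namespace IsMatchingIn

variable {α : Type u} {Γ : SimpleGraph α} {S : Finset α} {M : Finset (Finset α)}

theorem mono (h : IsMatchingIn Γ S M) {M' : Finset (Finset α)} (hM : M' ⊆ M) :
    IsMatchingIn Γ S M' :=
  ⟨fun e he => h.subset e (hM he), fun e he => h.clique e (hM he),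
    fun e he f hf => h.disjoint e (hM he) f (hM hf)⟩

variable [DecidableEq α]

theorem card_biUnion (h : IsMatchingIn Γ S M) : (M.biUnion id).card = 2 * M.card := by
  rw [Finset.card_biUnion (t := id) h.disjoint, mul_comm]
  exact Finset.sum_const_nat fun e he => (h.clique e he).card_eq

theorem biUnion_subset (h : IsMatchingIn Γ S M) : M.biUnion id ⊆ S :=
  Finset.biUnion_subset.2 h.subset

theorem card_filter_not_disjoint_le (h : IsMatchingIn Γ S M) (Z : Finset α) :
    (M.filter fun e => ¬ Disjoint e Z).card ≤ Z.card := by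
  have h1 : (M.filter fun e => ¬ Disjoint e Z) ⊆ Z.biUnion fun z => M.filter fun e => z ∈ e := by
    intro e he
    obtain ⟨heM, heZ⟩ := Finset.mem_filter.1 he
    obtain ⟨z, hze, hzZ⟩ := Finset.not_disjoint_iff.1 heZ
    exact Finset.mem_biUnion.2 ⟨z, hzZ, Finset.mem_filter.2 ⟨heM, hze⟩⟩
  refine (Finset.card_le_card h1).trans ?_
  refine (Finset.card_biUnion_le_card_mul _ _ 1 fun z _ => Finset.card_le_one.2 ?_).trans_eq
    (mul_one _)
  intro e he f hf
  by_contra hne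
  exact Finset.disjoint_left.1 (h.disjoint e (Finset.mem_filter.1 he).1 f
    (Finset.mem_filter.1 hf).1 hne) (Finset.mem_filter.1 he).2 (Finset.mem_filter.1 hf).2

end IsMatchingIn

/-! ### Hall's theorem under expansion -/

/-- Hall's condition for a bipartite relation between sets of equal size in which all degrees are
at least `t` and in which any `t` elements on the right see all but fewer than `t` elements on the
left. -/
theorem exists_perfect_matching_of_expansion {ι κ : Type*} [DecidableEq ι] [DecidableEq κ]
    [Nonempty κ] (r : ι → κ → Prop) [∀ i, DecidablePred (r i)] [∀ j, DecidablePred fun i => r i j]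
    (M : Finset ι) (W : Finset κ) (t : ℝ)
    (hcard : M.card = W.card)
    (hleft : ∀ i ∈ M, t ≤ ((W.filter (r i)).card : ℝ))
    (hright : ∀ j ∈ W, t ≤ ((M.filter fun i => r i j).card : ℝ))
    (hexp : ∀ Y ⊆ W, t ≤ (Y.card : ℝ) →
      ((M.filter fun i => ∀ j ∈ Y, ¬ r i j).card : ℝ) < t) :
    ∃ f : ι → κ, Set.InjOn f M ∧ (∀ i ∈ M, f i ∈ W ∧ r i (f i)) ∧ M.image f = W := by
  have hall := (Finset.all_card_le_biUnion_card_iff_exists_injective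
    (fun i : M => W.filter (r i))).1 ?_
  · obtain ⟨f, hf, hfr⟩ := hall
    have hfr' : ∀ i : M, f i ∈ W ∧ r i (f i) := fun i => by simpa using hfr i
    rcases M.eq_empty_or_nonempty with rfl | ⟨i₀, hi₀⟩
    · have : W = ∅ := Finset.card_eq_zero.1 (by simpa using hcard.symm)
      subst this
      exact ⟨fun _ => Classical.arbitrary κ, by simp, by simp, by simp⟩
    · let g : ι → κ := fun i => if h : i ∈ M then f ⟨i, h⟩ else f ⟨i₀, hi₀⟩
      have hg : ∀ i (h : i ∈ M), g i = f ⟨i, h⟩ := fun i h => by simp [g, h]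
      have hinj : Set.InjOn g M := by
        intro i hi j hj hij
        rw [hg i hi, hg j hj] at hij
        simpa using hf hij
      have hmem : ∀ i ∈ M, g i ∈ W ∧ r i (g i) := by
        intro i hi
        rw [hg i hi]
        exact hfr' ⟨i, hi⟩
      refine ⟨g, hinj, hmem, Finset.eq_of_subset_of_card_le ?_ ?_⟩
      · exact Finset.image_subset_iff.2 fun i hi => (hmem i hi).1
      · rw [Finset.card_image_of_injOn hinj, hcard]
  · intro s
    set X : Finset ι := s.map (Function.Embedding.subtype _) with hX
    have hXM : X ⊆ M := by
      intro i hi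
      simp only [hX, Finset.mem_map, Function.Embedding.coe_subtype, Subtype.exists] at hi
      obtain ⟨a, ha, -, rfl⟩ := hi
      exact ha
    have hXc : X.card = s.card := Finset.card_map _
    set Y := s.biUnion fun i : M => W.filter (r i) with hY
    have hYW : Y ⊆ W := Finset.biUnion_subset.2 fun i _ => Finset.filter_subset _ _
    rw [← hXc]
    by_cases hs : s = ∅
    · simp [hX, hs]
    obtain ⟨i, hi⟩ := Finset.nonempty_iff_ne_empty.2 hs
    have hYt : t ≤ (Y.card : ℝ) := (hleft i i.2).trans (by
      exact_mod_cast Finset.card_le_card (Finset.subset_biUnion_of_mem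
        (fun i : M => W.filter (r i)) hi))
    -- If |N(X)| < |X|, then |X| > t by the left degrees, so expansion forces |W \ N(X)| < t. A
    -- vertex of this nonempty set has all its neighbours in M \ X, which is no larger, against the
    -- right degrees.
    by_contra! hlt
    have hXt : t < (X.card : ℝ) := hYt.trans_lt (by exact_mod_cast hlt)
    have hnon : ∀ i ∈ X, ∀ j ∈ W \ Y, ¬ r i j := by
      intro i hi j hj hij
      simp only [hX, Finset.mem_map, Function.Embedding.coe_subtype] at hi
      obtain ⟨a, ha, rfl⟩ := hi
      refine (Finset.mem_sdiff.1 hj).2 (Finset.mem_biUnion.2 ⟨a, ha, ?_⟩)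
      exact Finset.mem_filter.2 ⟨(Finset.mem_sdiff.1 hj).1, hij⟩
    have hlt' : ((W \ Y).card : ℝ) < t := by
      by_contra! hge
      have h1 := hexp (W \ Y) Finset.sdiff_subset hge
      have h2 : X ⊆ M.filter fun i => ∀ j ∈ W \ Y, ¬ r i j := fun i hi =>
        Finset.mem_filter.2 ⟨hXM hi, hnon i hi⟩
      have h3 : (X.card : ℝ) ≤ _ := Nat.cast_le.2 (Finset.card_le_card h2)
      linarith
    have hXle := Finset.card_le_card hXM
    obtain ⟨j, hj⟩ : (W \ Y).Nonempty := by
      rw [← Finset.card_pos, Finset.card_sdiff_of_subset hYW]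
      omega
    have h4 := hright j (Finset.mem_sdiff.1 hj).1
    have h5 : (M.filter fun i => r i j) ⊆ M \ X := fun i hi =>
      Finset.mem_sdiff.2 ⟨(Finset.mem_filter.1 hi).1,
        fun h => hnon i h j hj (Finset.mem_filter.1 hi).2⟩
    have h6 := Finset.card_le_card h5
    rw [Finset.card_sdiff_of_subset hXM] at h6
    rw [Finset.card_sdiff_of_subset hYW] at hlt'
    have h7 : W.card - Y.card ≥ M.card - X.card := by omega
    have h8 : ((M.filter fun i => r i j).card : ℝ) ≤ ((W.card - Y.card : ℕ) : ℝ) := by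
      exact_mod_cast h6.trans h7
    linarith

/-! ### Rich graphs: matchings, covers and tilings -/

/-- The graph `Γ` has an edge in every large subset of `A`, and only few edges of `Γ` in `A` have
few common `G`-neighbours in any given large subset of `B`. -/
structure IsRich {α : Type u} (G : SimpleGraph α) [DecidableRel G.Adj] (Γ : SimpleGraph α)
    (A B : Finset α) (d s t : ℝ) : Prop where
  exists_edge : ∀ S ⊆ A, s ≤ (S.card : ℝ) → ∃ e ⊆ S, Γ.IsNClique 2 e
  few_bad : ∀ Y ⊆ B, t ≤ (Y.card : ℝ) → ∀ F : Finset (Finset α),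
    (∀ e ∈ F, e ⊆ A ∧ Γ.IsNClique 2 e ∧
      ((Y.filter fun y => ∀ a ∈ e, G.Adj a y).card : ℝ) < d ^ 2 * Y.card) → (F.card : ℝ) < t

namespace IsRich

variable {α : Type u} [DecidableEq α] {G : SimpleGraph α} [DecidableRel G.Adj] {Γ P : SimpleGraph α}
  {A B : Finset α} {d s t : ℝ}

theorem exists_matching (h : IsRich G Γ A B d s t) (hs : 0 ≤ s) (m : ℕ)
    (hm : 2 * (m : ℝ) + s ≤ A.card) :
    ∃ M, IsMatchingIn Γ A M ∧ M.card = m := by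
  induction m with
  | zero => exact ⟨∅, ⟨by simp, by simp, by simp⟩, rfl⟩
  | succ m ih =>
    push_cast at hm
    obtain ⟨M, hM, hMc⟩ := ih (by linarith)
    obtain ⟨e, heS, heΓ⟩ := h.exists_edge (A \ M.biUnion id) Finset.sdiff_subset (by
      rw [Finset.card_sdiff_of_subset hM.biUnion_subset, hM.card_biUnion, hMc, Nat.cast_sub]
      · push_cast
        linarith
      · have : (2 * (m : ℝ)) ≤ A.card := by linarith
        exact_mod_cast this)
    have hdis : ∀ f ∈ M, Disjoint e f := fun f hf =>
      (Finset.sdiff_disjoint.mono_left heS).mono_right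
        (Finset.subset_biUnion_of_mem id hf)
    have heM : e ∉ M := fun he => by
      have h1 := disjoint_self.1 (hdis e he)
      have h2 := heΓ.card_eq
      simp [h1] at h2
    refine ⟨insert e M, ⟨?_, ?_, ?_⟩, ?_⟩
    · simpa using ⟨heS.trans Finset.sdiff_subset, hM.subset⟩
    · simpa using ⟨heΓ, hM.clique⟩
    · intro f hf g hg hfg
      rcases Finset.mem_insert.1 hf with hfe | hf <;>
        rcases Finset.mem_insert.1 hg with hge | hg
      · exact absurd (hfe.trans hge.symm) hfg
      · exact hfe ▸ hdis g hg
      · exact hge ▸ (hdis f hf).symm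
      · exact hM.disjoint f hf g hg hfg
    · rw [Finset.card_insert_of_notMem heM, hMc]

/-- Greedy covering of a small set by triangles with the remaining two vertices in `A`. -/
theorem exists_cover (h : IsRich G Γ A B d s t) (hGP : G ≤ P) (hΓP : Γ ≤ P)
    (Z D : Finset α) (hDA : Disjoint D A)
    (hdeg : ∀ v ∈ D, (Z.card : ℝ) + 2 * D.card + s ≤ (A.filter fun a => G.Adj v a).card) :
    ∃ E ⊆ A \ Z, E.card = 2 * D.card ∧ HasTriangleTiling P (D ∪ E) := by
  suffices H : ∀ D' ⊆ D, ∃ E ⊆ A \ Z, E.card = 2 * D'.card ∧ HasTriangleTiling P (D' ∪ E) from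
    H D subset_rfl
  intro D'
  induction D' using Finset.induction_on with
  | empty => exact fun _ => ⟨∅, by simp, by simp, by simpa using HasTriangleTiling.empty P⟩
  | insert v D' hv ih =>
    intro hD'
    obtain ⟨E, hE, hEc, hET⟩ := ih ((Finset.subset_insert _ _).trans hD')
    have hvD : v ∈ D := hD' (Finset.mem_insert_self _ _)
    have hcard : D'.card + 1 ≤ D.card := by
      rw [← Finset.card_insert_of_notMem hv]
      exact Finset.card_le_card hD'
    obtain ⟨e, heS, heΓ⟩ := h.exists_edge ((A.filter fun a => G.Adj v a) \ (Z ∪ E))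
      (Finset.sdiff_subset.trans (Finset.filter_subset _ _)) (by
        have h1 := Finset.le_card_sdiff (Z ∪ E) (A.filter fun a => G.Adj v a)
        have h2 := Finset.card_union_le Z E
        have h3 : ((A.filter fun a => G.Adj v a).card : ℝ) ≤
            (((A.filter fun a => G.Adj v a) \ (Z ∪ E)).card : ℝ) + (Z.card + 2 * D.card : ℕ) := by
          norm_cast
          omega
        have h4 := hdeg v hvD
        push_cast at h3
        linarith)
    have heA : e ⊆ A := heS.trans (Finset.sdiff_subset.trans (Finset.filter_subset _ _))
    have heZE : Disjoint e (Z ∪ E) := Finset.sdiff_disjoint.mono_left heS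
    have heE : Disjoint E e := (heZE.mono_right Finset.subset_union_right).symm
    refine ⟨E ∪ e, Finset.union_subset hE ?_, ?_, ?_⟩
    · exact fun a ha => Finset.mem_sdiff.2 ⟨heA ha, fun haZ =>
        Finset.disjoint_left.1 heZE ha (Finset.mem_union_left _ haZ)⟩
    · rw [Finset.card_union_of_disjoint heE, hEc, Finset.card_insert_of_notMem hv, heΓ.card_eq,
        mul_add]
    · have hEA : E ⊆ A := hE.trans Finset.sdiff_subset
      have h5 : insert v D' ∪ (E ∪ e) = (D' ∪ E) ∪ insert v e := by
        grind
      rw [h5]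
      refine hET.union (hasTriangleTiling_insert (heΓ.mono hΓP) fun a ha => hGP ?_) ?_
      · have := heS ha
        simp only [Finset.mem_sdiff, Finset.mem_filter] at this
        exact this.1.2
      · have hvA : v ∉ A := Finset.disjoint_left.1 hDA hvD
        have h6 : Disjoint D' e :=
          hDA.mono ((Finset.subset_insert _ _).trans hD') heA
        simp only [Finset.disjoint_insert_right, Finset.mem_union, Finset.disjoint_union_left]
        exact ⟨fun h => h.elim hv fun h => hvA (hEA h), h6, heE⟩

/-- Few vertices of `B` have small degree in the auxiliary graph on a large matching. -/
theorem card_low_lt (h : IsRich G Γ A B d s t) (ht : 0 < t) {M : Finset (Finset α)}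
    (hM : IsMatchingIn Γ A M) {q : ℝ} (hq : q ≤ d ^ 2 * (M.card - t)) :
    ((B.filter fun v => ((M.filter fun e => ∀ a ∈ e, G.Adj a v).card : ℝ) < q).card : ℝ) < t := by
  classical
  by_contra! hge
  set Y := B.filter fun v => ((M.filter fun e => ∀ a ∈ e, G.Adj a v).card : ℝ) < q with hY
  have hYpos : (0 : ℝ) < Y.card := ht.trans_le hge
  set F := M.filter fun e => ((Y.filter fun y => ∀ a ∈ e, G.Adj a y).card : ℝ) < d ^ 2 * Y.card
    with hF
  have hFc := h.few_bad Y (Finset.filter_subset _ _) hge F fun e he => by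
    obtain ⟨he1, he2⟩ := Finset.mem_filter.1 he
    exact ⟨hM.subset e he1, hM.clique e he1, he2⟩
  -- Double counting of auxiliary edges between M and Y: all but fewer than t edges of M contribute
  -- at least d²|Y|, while each vertex of Y contributes less than q.
  have hdc : ∑ e ∈ M, ((Y.filter fun y => ∀ a ∈ e, G.Adj a y).card : ℝ) =
      ∑ y ∈ Y, ((M.filter fun e => ∀ a ∈ e, G.Adj a y).card : ℝ) := by
    exact_mod_cast Finset.sum_card_bipartiteAbove_eq_sum_card_bipartiteBelow
      (s := M) (t := Y) fun e y => ∀ a ∈ e, G.Adj a y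
  have hup : ∑ y ∈ Y, ((M.filter fun e => ∀ a ∈ e, G.Adj a y).card : ℝ) < Y.card * q := by
    rw [← nsmul_eq_mul, ← Finset.sum_const]
    exact Finset.sum_lt_sum_of_nonempty (Finset.card_pos.1 (by exact_mod_cast hYpos))
      fun y hy => (Finset.mem_filter.1 hy).2
  have hlow : ((M \ F).card : ℝ) * (d ^ 2 * Y.card) ≤
      ∑ e ∈ M, ((Y.filter fun y => ∀ a ∈ e, G.Adj a y).card : ℝ) := by
    rw [← nsmul_eq_mul, ← Finset.sum_const]
    refine (Finset.sum_le_sum fun e he => ?_).trans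
      (Finset.sum_le_sum_of_subset_of_nonneg (Finset.sdiff_subset (s := M) (t := F))
        fun _ _ _ => by positivity)
    obtain ⟨he1, he2⟩ := Finset.mem_sdiff.1 he
    by_contra! hlt
    exact he2 (Finset.mem_filter.2 ⟨he1, hlt⟩)
  have hcard : (M.card : ℝ) - t ≤ (M \ F).card := by
    have h1 : M.card ≤ (M \ F).card + F.card := by
      rw [Finset.card_sdiff_add_card_eq_card (Finset.filter_subset _ _)]
    have h2 : (M.card : ℝ) ≤ (M \ F).card + F.card := by exact_mod_cast h1
    linarith
  have h3 : (M.card - t) * (d ^ 2 * Y.card) ≤ (M \ F).card * (d ^ 2 * Y.card) :=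
    mul_le_mul_of_nonneg_right hcard (by positivity)
  have h4 : Y.card * q ≤ Y.card * (d ^ 2 * (M.card - t)) :=
    mul_le_mul_of_nonneg_left hq hYpos.le
  nlinarith

/-- A matching with large degrees into `W` and from `W` yields a tiling. -/
theorem hasTriangleTiling (h : IsRich G Γ A B d s t) (hd : 0 < d) (ht : 0 < t)
    (hGP : G ≤ P) (hΓP : Γ ≤ P) (hAB : Disjoint A B) {M : Finset (Finset α)} {W : Finset α}
    (hM : IsMatchingIn Γ A M) (hW : W ⊆ B) (hcard : M.card = W.card)
    (hleft : ∀ e ∈ M, t ≤ ((W.filter fun v => ∀ a ∈ e, G.Adj a v).card : ℝ))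
    (hright : ∀ v ∈ W, t ≤ ((M.filter fun e => ∀ a ∈ e, G.Adj a v).card : ℝ)) :
    HasTriangleTiling P (M.biUnion id ∪ W) := by
  rcases isEmpty_or_nonempty α with hα | hα
  · rw [Finset.eq_empty_of_isEmpty (M.biUnion id ∪ W)]
    exact HasTriangleTiling.empty P
  obtain ⟨f, hf, hfr, hfW⟩ := exists_perfect_matching_of_expansion
    -- An edge unrelated to all of Y has no common neighbour there, hence is bad for Y; so richness
    -- supplies the expansion.
    (fun (e : Finset α) v => ∀ a ∈ e, G.Adj a v) M W t hcard hleft hright fun Y hY hYt => by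
      refine h.few_bad Y (hY.trans hW) hYt _ fun e he => ?_
      obtain ⟨he1, he2⟩ := Finset.mem_filter.1 he
      refine ⟨hM.subset e he1, hM.clique e he1, ?_⟩
      rw [Finset.filter_false_of_mem he2]
      have : (0 : ℝ) < Y.card := ht.trans_le hYt
      simp only [Finset.card_empty, Nat.cast_zero]
      positivity
  have hU : M.biUnion id ∪ W = M.biUnion fun e => insert (f e) e := by
    ext x
    simp only [← hfW, Finset.mem_union, Finset.mem_biUnion, Finset.mem_image, Finset.mem_insert,
      id]
    constructor
    · rintro (⟨e, he, hx⟩ | ⟨e, he, rfl⟩)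
      · exact ⟨e, he, Or.inr hx⟩
      · exact ⟨e, he, Or.inl rfl⟩
    · rintro ⟨e, he, rfl | hx⟩
      · exact Or.inr ⟨e, he, rfl⟩
      · exact Or.inl ⟨e, he, hx⟩
  rw [hU]
  refine HasTriangleTiling.biUnion M _ (fun e he => ?_) fun e he e' he' hne => ?_
  · exact hasTriangleTiling_insert ((hM.clique e he).mono hΓP)
      fun a ha => hGP ((hfr e he).2 a ha).symm
  · have key : ∀ e ∈ M, ∀ e' ∈ M, f e ∉ e' := fun e he e' he' hx =>
      Finset.disjoint_left.1 hAB (hM.subset e' he' hx) (hW (hfr e he).1)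
    simp only [Finset.disjoint_insert_left, Finset.disjoint_insert_right, Finset.mem_insert,
      not_or]
    exact ⟨⟨fun h => hne (hf he he' h.symm), key e' he' e he⟩, key e he e' he',
      hM.disjoint e he e' he' hne⟩

end IsRich

namespace IsRich

variable {α : Type u} [DecidableEq α] {G : SimpleGraph α} [DecidableRel G.Adj] {Γ P : SimpleGraph α}
  {A B : Finset α} {d s t : ℝ}

/-- Passing to a submatching of prescribed size which avoids `Z` and all of whose edges have many
common neighbours in `W`. -/
theorem exists_trim (h : IsRich G Γ A B d s t) {M : Finset (Finset α)} (hM : IsMatchingIn Γ A M)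
    (Z W : Finset α) (hW : W ⊆ B) (hWt : t ≤ W.card) (m : ℕ)
    (hm : (m : ℝ) + Z.card + t ≤ M.card) :
    ∃ M' ⊆ M, M'.card = m ∧ ∀ e ∈ M', Disjoint e Z ∧
      d ^ 2 * W.card ≤ ((W.filter fun y => ∀ a ∈ e, G.Adj a y).card : ℝ) := by
  classical
  set F := M.filter fun e => ((W.filter fun y => ∀ a ∈ e, G.Adj a y).card : ℝ) < d ^ 2 * W.card
    with hF
  have hFc := h.few_bad W hW hWt F fun e he => by
    obtain ⟨he1, he2⟩ := Finset.mem_filter.1 he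
    exact ⟨hM.subset e he1, hM.clique e he1, he2⟩
  have hZc := hM.card_filter_not_disjoint_le Z
  set K := M.filter fun e => ¬ Disjoint e Z
  have h1 := Finset.le_card_sdiff (K ∪ F) M
  have h2 := Finset.card_union_le K F
  have h3 : (M.card : ℝ) ≤ (M \ (K ∪ F)).card + (K.card + F.card) := by
    norm_cast
    omega
  have h4 : (K.card : ℝ) ≤ Z.card := by exact_mod_cast hZc
  have h5 : m ≤ (M \ (K ∪ F)).card := by
    have : (m : ℝ) ≤ (M \ (K ∪ F)).card := by linarith
    exact_mod_cast this
  obtain ⟨M', hM', hc⟩ := Finset.exists_subset_card_eq h5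
  refine ⟨M', hM'.trans Finset.sdiff_subset, hc, fun e he => ?_⟩
  obtain ⟨heM, hen⟩ := Finset.mem_sdiff.1 (hM' he)
  rw [Finset.mem_union, not_or] at hen
  constructor
  · by_contra hcon
    exact hen.1 (Finset.mem_filter.2 ⟨heM, hcon⟩)
  · by_contra! hcon
    exact hen.2 (Finset.mem_filter.2 ⟨heM, hcon⟩)

/-- Tiling after trimming: `M'` is the trimmed matching, `W'` contains most of `W`. -/
theorem hasTriangleTiling_of_trim (h : IsRich G Γ A B d s t) (hd : 0 < d) (ht : 0 < t)
    (hGP : G ≤ P) (hΓP : Γ ≤ P) (hAB : Disjoint A B) {M M' : Finset (Finset α)}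
    {W W' Z : Finset α} {q : ℝ}
    (hM : IsMatchingIn Γ A M) (hMM : M' ⊆ M) (hMc : (M.card : ℝ) + t ≤ M'.card + q)
    (hWB : W' ⊆ B) (hWW : W \ Z ⊆ W') (hZ : (Z.card : ℝ) + t ≤ d ^ 2 * W.card)
    (hcard : M'.card = W'.card)
    (hleft : ∀ e ∈ M', d ^ 2 * W.card ≤ ((W.filter fun v => ∀ a ∈ e, G.Adj a v).card : ℝ))
    (hright : ∀ v ∈ W', q ≤ ((M.filter fun e => ∀ a ∈ e, G.Adj a v).card : ℝ)) :
    HasTriangleTiling P (M'.biUnion id ∪ W') := by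
  refine h.hasTriangleTiling hd ht hGP hΓP hAB (hM.mono hMM) hWB hcard (fun e he => ?_)
    fun v hv => ?_
  · have h1 : (W.filter fun v => ∀ a ∈ e, G.Adj a v) ⊆
        (W'.filter fun v => ∀ a ∈ e, G.Adj a v) ∪ Z := by
      intro v hv
      obtain ⟨hv1, hv2⟩ := Finset.mem_filter.1 hv
      by_cases hvZ : v ∈ Z
      · exact Finset.mem_union_right _ hvZ
      · exact Finset.mem_union_left _
          (Finset.mem_filter.2 ⟨hWW (Finset.mem_sdiff.2 ⟨hv1, hvZ⟩), hv2⟩)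
    have h2 := (Finset.card_le_card h1).trans (Finset.card_union_le _ _)
    have h3 : ((W.filter fun v => ∀ a ∈ e, G.Adj a v).card : ℝ) ≤
        (W'.filter fun v => ∀ a ∈ e, G.Adj a v).card + Z.card := by exact_mod_cast h2
    have h4 := hleft e he
    linarith
  · have h1 : (M.filter fun e => ∀ a ∈ e, G.Adj a v) ⊆
        (M'.filter fun e => ∀ a ∈ e, G.Adj a v) ∪ (M \ M') := by
      intro e he
      obtain ⟨he1, he2⟩ := Finset.mem_filter.1 he
      by_cases heM : e ∈ M'
      · exact Finset.mem_union_left _ (Finset.mem_filter.2 ⟨heM, he2⟩)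
      · exact Finset.mem_union_right _ (Finset.mem_sdiff.2 ⟨he1, heM⟩)
    have h2 := (Finset.card_le_card h1).trans (Finset.card_union_le _ _)
    have h3 : ((M.filter fun e => ∀ a ∈ e, G.Adj a v).card : ℝ) ≤
        (M'.filter fun e => ∀ a ∈ e, G.Adj a v).card + (M \ M').card := by exact_mod_cast h2
    have h5 : ((M \ M').card : ℝ) + M'.card = M.card := by
      exact_mod_cast Finset.card_sdiff_add_card_eq_card hMM
    have h4 := hright v hv
    linarith

end IsRich

/-! ### Deterministic construction of the tiling -/

-- With d²n = 200t all errors are small multiples of t. Linear quantities are at least n/12, so the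
-- common neighbourhoods and auxiliary degrees used are at least about d²n/12 > 16t.
set_option maxHeartbeats 1000000 in
theorem hasTriangleTiling_of_isRich {α : Type u} [DecidableEq α] {G : SimpleGraph α}
    [DecidableRel G.Adj] {Γ Γ' P : SimpleGraph α} {U V : Finset α} {d n t : ℝ}
    (hd : 0 < d) (hd1 : d < 1) (hGP : G ≤ P) (hΓP : Γ ≤ P) (hΓP' : Γ' ≤ P)
    (hUV : Disjoint U V) (hV : (V.card : ℝ) = n) (hU : 3 * n / 4 ≤ U.card) (hUn : U.card ≤ n)
    (hdvd : 3 ∣ U.card + V.card) (ht : t = d ^ 2 / 200 * n) (ht1 : 1 ≤ t)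
    (hrich : IsRich G Γ U V d (d / 10 * n) t) (hrich' : IsRich G Γ' V U d (d / 10 * n) t)
    (hdegU : ∀ a ∈ U, d * (V.card : ℝ) ≤ ((V.filter fun b => G.Adj a b).card : ℝ))
    (hdegV : ∀ b ∈ V, d * (U.card : ℝ) ≤ ((U.filter fun a => G.Adj b a).card : ℝ)) :
    HasTriangleTiling P (U ∪ V) := by
  have hn : 0 < n := by
    by_contra! hcon
    have : d ^ 2 / 200 * n ≤ 0 := mul_nonpos_of_nonneg_of_nonpos (by positivity) hcon
    linarith
  have hdn : 0 < d * n := by positivity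
  have hdd : d ^ 2 ≤ d := by nlinarith
  have ht2 : t ≤ d * n / 200 := by rw [ht]; nlinarith
  have hdn1 : d * n ≤ n := by nlinarith
  have ht0 : 0 < t := by linarith
  have hd2n : d ^ 2 * n = 200 * t := by rw [ht]; ring
  obtain ⟨x, y, hx, hy⟩ : ∃ x y : ℕ, 2 * x + y = U.card ∧ x + 2 * y = V.card := by
    have h1 : (U.card : ℝ) ≤ V.card := by linarith
    have h2 : 3 * (V.card : ℝ) ≤ 4 * U.card := by linarith
    have h1' : U.card ≤ V.card := by exact_mod_cast h1
    have h2' : 3 * V.card ≤ 4 * U.card := by exact_mod_cast h2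
    exact ⟨(2 * U.card - V.card) / 3, (2 * V.card - U.card) / 3, by omega, by omega⟩
  have hxR : 2 * (x : ℝ) + y = U.card := by exact_mod_cast hx
  have hyR : (x : ℝ) + 2 * y = V.card := by exact_mod_cast hy
  have hxn : n / 6 ≤ (x : ℝ) := by linarith
  have hyn : n / 3 ≤ (y : ℝ) := by linarith
  -- Spare edges: trimming loses at most |LU| + |LV| + t < 3t edges beyond those made superfluous by
  -- the cover.
  set k := ⌈4 * t⌉₊ with hk
  have hk1 : 4 * t ≤ k := Nat.le_ceil _
  have hk2 : (k : ℝ) ≤ 5 * t := by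
    have := Nat.ceil_lt_add_one (a := 4 * t) (by linarith)
    linarith
  have hs0 : 0 ≤ d / 10 * n := by positivity
  obtain ⟨M, hM, hMc⟩ := hrich.exists_matching hs0 (x + k) (by push_cast; linarith)
  obtain ⟨M', hM', hMc'⟩ := hrich'.exists_matching hs0 (y + k) (by push_cast; linarith)
  have hMcR : (M.card : ℝ) = x + k := by exact_mod_cast hMc
  have hMcR' : (M'.card : ℝ) = y + k := by exact_mod_cast hMc'
  have hlow := hrich.card_low_lt ht0 hM (q := 16 * t) (by
    have : d ^ 2 * (n / 12) ≤ d ^ 2 * (M.card - t) :=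
      mul_le_mul_of_nonneg_left (by linarith) (by positivity)
    linarith)
  have hlow' := hrich'.card_low_lt ht0 hM' (q := 16 * t) (by
    have : d ^ 2 * (n / 12) ≤ d ^ 2 * (M'.card - t) :=
      mul_le_mul_of_nonneg_left (by linarith) (by positivity)
    linarith)
  set LV := V.filter fun v => ((M.filter fun e => ∀ a ∈ e, G.Adj a v).card : ℝ) < 16 * t with hLV
  set LU := U.filter fun v => ((M'.filter fun e => ∀ a ∈ e, G.Adj a v).card : ℝ) < 16 * t with hLU
  have hLVV : LV ⊆ V := Finset.filter_subset _ _
  have hLUU : LU ⊆ U := Finset.filter_subset _ _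
  obtain ⟨E, hE, hEc, hET⟩ := hrich.exists_cover hGP hΓP LU LV (hUV.symm.mono_left hLVV)
    fun v hv => by
      have h1 := hdegV v (hLVV hv)
      have h2 : d * (3 * n / 4) ≤ d * U.card := mul_le_mul_of_nonneg_left hU hd.le
      linarith
  obtain ⟨E', hE', hEc', hET'⟩ := hrich'.exists_cover hGP hΓP' LV LU (hUV.mono_left hLUU)
    fun v hv => by
      have h1 := hdegU v (hLUU hv)
      rw [hV] at h1
      linarith
  have hEU : E ⊆ U := hE.trans Finset.sdiff_subset
  have hEV : E' ⊆ V := hE'.trans Finset.sdiff_subset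
  have hdE : Disjoint LU E := (Finset.disjoint_sdiff.mono_right hE)
  have hdE' : Disjoint LV E' := (Finset.disjoint_sdiff.mono_right hE')
  have hZU : (LU ∪ E).card = LU.card + 2 * LV.card := by
    rw [Finset.card_union_of_disjoint hdE, hEc]
  have hZV : (LV ∪ E').card = LV.card + 2 * LU.card := by
    rw [Finset.card_union_of_disjoint hdE', hEc']
  have hZUR : ((LU ∪ E).card : ℝ) = LU.card + 2 * LV.card := by exact_mod_cast hZU
  have hZVR : ((LV ∪ E').card : ℝ) = LV.card + 2 * LU.card := by exact_mod_cast hZV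
  set ZU := LU ∪ E
  set ZV := LV ∪ E'
  have hZUU : ZU ⊆ U := Finset.union_subset hLUU hEU
  have hZVV : ZV ⊆ V := Finset.union_subset hLVV hEV
  have hlx : LV.card ≤ x := by
    have : (LV.card : ℝ) ≤ x := by linarith
    exact_mod_cast this
  have hly : LU.card ≤ y := by
    have : (LU.card : ℝ) ≤ y := by linarith
    exact_mod_cast this
  have hMU : M.biUnion id ⊆ U := hM.biUnion_subset
  have hMV : M'.biUnion id ⊆ V := hM'.biUnion_subset
  have hWV : ((V \ M'.biUnion id).card : ℝ) = x - 2 * k := by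
    have h1 := Finset.card_sdiff_add_card_eq_card hMV
    rw [hM'.card_biUnion, hMc'] at h1
    have h2 : ((V \ M'.biUnion id).card : ℝ) + 2 * (y + k) = V.card := by exact_mod_cast h1
    linarith
  have hWU : ((U \ M.biUnion id).card : ℝ) = y - 2 * k := by
    have h1 := Finset.card_sdiff_add_card_eq_card hMU
    rw [hM.card_biUnion, hMc] at h1
    have h2 : ((U \ M.biUnion id).card : ℝ) + 2 * (x + k) = U.card := by exact_mod_cast h1
    linarith
  -- The apices available for one matching depend on how the other is trimmed. To avoid circularity,
  -- each is trimmed against the vertices missed by the whole other matching; up to `ZV` or `ZU`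
  -- these lie in the final apex set.
  obtain ⟨N, hNM, hNc, hN⟩ := hrich.exists_trim hM ZU (V \ M'.biUnion id) Finset.sdiff_subset
    (by linarith) (x - LV.card) (by rw [Nat.cast_sub hlx]; linarith)
  obtain ⟨N', hNM', hNc', hN'⟩ := hrich'.exists_trim hM' ZV (U \ M.biUnion id) Finset.sdiff_subset
    (by linarith) (y - LU.card) (by rw [Nat.cast_sub hly]; linarith)
  have hNcR : (N.card : ℝ) = x - LV.card := by rw [hNc, Nat.cast_sub hlx]
  have hNcR' : (N'.card : ℝ) = y - LU.card := by rw [hNc', Nat.cast_sub hly]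
  have hNU : N.biUnion id ⊆ U \ ZU := Finset.biUnion_subset.2 fun e he a ha =>
    Finset.mem_sdiff.2 ⟨hM.subset e (hNM he) ha, Finset.disjoint_left.1 (hN e he).1 ha⟩
  have hNV : N'.biUnion id ⊆ V \ ZV := Finset.biUnion_subset.2 fun e he a ha =>
    Finset.mem_sdiff.2 ⟨hM'.subset e (hNM' he) ha, Finset.disjoint_left.1 (hN' e he).1 ha⟩
  have hNMs : N.biUnion id ⊆ M.biUnion id := Finset.biUnion_subset_biUnion_of_subset_left _ hNM
  have hNMs' : N'.biUnion id ⊆ M'.biUnion id := Finset.biUnion_subset_biUnion_of_subset_left _ hNM'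
  set W := (V \ ZV) \ N'.biUnion id with hW
  set W' := (U \ ZU) \ N.biUnion id with hW'
  -- The sizes fit: |V| - (|LV| + 2|LU|) - 2(y - |LU|) = x - |LV|.
  have hWc : N.card = W.card := by
    rw [hW, Finset.card_sdiff_of_subset hNV, Finset.card_sdiff_of_subset hZVV,
      (hM'.mono hNM').card_biUnion, hNc, hNc', hZV]
    omega
  have hWc' : N'.card = W'.card := by
    rw [hW', Finset.card_sdiff_of_subset hNU, Finset.card_sdiff_of_subset hZUU,
      (hM.mono hNM).card_biUnion, hNc, hNc', hZU]
    omega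
  have hWV' : W ⊆ V := Finset.sdiff_subset.trans Finset.sdiff_subset
  have hWU' : W' ⊆ U := Finset.sdiff_subset.trans Finset.sdiff_subset
  have T := hrich.hasTriangleTiling_of_trim (P := P) (W := V \ M'.biUnion id) (W' := W) (Z := ZV)
    (q := 16 * t) hd ht0 hGP hΓP hUV hM hNM (by linarith) hWV'
    (by
      intro v hv
      simp only [Finset.mem_sdiff] at hv
      simp only [hW, Finset.mem_sdiff]
      exact ⟨⟨hv.1.1, hv.2⟩, fun h => hv.1.2 (hNMs' h)⟩)
    (by
      have : d ^ 2 * (n / 12) ≤ d ^ 2 * (V \ M'.biUnion id).card :=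
        mul_le_mul_of_nonneg_left (by linarith) (by positivity)
      linarith) hWc (fun e he => (hN e he).2)
    (by
      intro v hv
      by_contra! hcon
      simp only [hW, Finset.mem_sdiff] at hv
      exact hv.1.2 (Finset.mem_union_left _ (Finset.mem_filter.2 ⟨hv.1.1, hcon⟩)))
  have T' := hrich'.hasTriangleTiling_of_trim (P := P) (W := U \ M.biUnion id) (W' := W') (Z := ZU)
    (q := 16 * t) hd ht0 hGP hΓP' hUV.symm hM' hNM' (by linarith) hWU'
    (by
      intro v hv
      simp only [Finset.mem_sdiff] at hv
      simp only [hW', Finset.mem_sdiff]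
      exact ⟨⟨hv.1.1, hv.2⟩, fun h => hv.1.2 (hNMs h)⟩)
    (by
      have : d ^ 2 * (n / 12) ≤ d ^ 2 * (U \ M.biUnion id).card :=
        mul_le_mul_of_nonneg_left (by linarith) (by positivity)
      linarith) hWc' (fun e he => (hN' e he).2)
    (by
      intro v hv
      by_contra! hcon
      simp only [hW', Finset.mem_sdiff] at hv
      exact hv.1.2 (Finset.mem_union_left _ (Finset.mem_filter.2 ⟨hv.1.1, hcon⟩)))
  have hcross : ∀ {S S' : Finset α}, S ⊆ U → S' ⊆ V → Disjoint S S' := fun h h' => hUV.mono h h'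
  have d1 : Disjoint (LV ∪ E) (LU ∪ E') := by
    simp only [Finset.disjoint_union_left, Finset.disjoint_union_right]
    exact ⟨⟨(hcross hLUU hLVV).symm, hdE.symm⟩, hdE', hcross hEU hEV⟩
  have hNU2 := hNU.trans Finset.sdiff_subset
  have hNV2 := hNV.trans Finset.sdiff_subset
  have d2 : Disjoint (N.biUnion id ∪ W) (N'.biUnion id ∪ W') := by
    rw [Finset.disjoint_union_left, Finset.disjoint_union_right, Finset.disjoint_union_right]
    exact ⟨⟨hcross hNU2 hNV2, Finset.disjoint_sdiff⟩, Finset.sdiff_disjoint,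
      (hcross hWU' hWV').symm⟩
  have e1 : (LV ∪ E) ∪ (LU ∪ E') = ZU ∪ ZV := by
    rw [Finset.union_comm LV E, Finset.union_union_union_comm, Finset.union_comm E LU]
  have e2 : (N.biUnion id ∪ W) ∪ (N'.biUnion id ∪ W') = (U \ ZU) ∪ (V \ ZV) := by
    rw [Finset.union_comm (N'.biUnion id) W', Finset.union_union_union_comm,
      Finset.union_comm W, hW, hW', Finset.union_sdiff_of_subset hNU,
      Finset.union_sdiff_of_subset hNV]
  have hfin := (hET.union hET' d1).union (T.union T' d2) (by
    rw [e1, e2, Finset.disjoint_union_left, Finset.disjoint_union_right,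
      Finset.disjoint_union_right]
    exact ⟨⟨Finset.disjoint_sdiff, hcross hZUU Finset.sdiff_subset⟩,
      (hcross Finset.sdiff_subset hZVV).symm, Finset.disjoint_sdiff⟩)
  rwa [e1, e2, Finset.union_union_union_comm, Finset.union_sdiff_of_subset hZUU,
    Finset.union_sdiff_of_subset hZVV] at hfin

/-! ### Binomial random sets and graphs: monotonicity and product formulas -/

section Bernoulli

open MeasureTheory ProbabilityTheory unitInterval

theorem map_volume_and_le_eq (P : Prop) (p : I) :
    (volume : Measure I).map (fun x => P ∧ x ≤ p) =
      toNNReal p • Measure.dirac P + toNNReal (σ p) • Measure.dirac False := by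
  have hm : Measurable fun x : I => P ∧ x ≤ p :=
    (measurable_const (a := P)).and (measurableSet_Iic (a := p)).mem
  refine Measure.ext_of_singleton fun Q => ?_
  rw [Measure.map_apply hm (by trivial)]
  by_cases hP : P <;> by_cases hQ : Q
  · have : (fun x : I => P ∧ x ≤ p) ⁻¹' {Q} = Set.Iic p := by
      ext; simp [hP, hQ]
    rw [this]
    simp [hP, hQ]
    exact ENNReal.ofReal_eq_coe_nnreal p.2.1
  · have : (fun x : I => P ∧ x ≤ p) ⁻¹' {Q} = Set.Ioi p := by
      ext; simp [hP, hQ]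
    rw [this]
    simp [hP, hQ]
    exact ENNReal.ofReal_eq_coe_nnreal (σ p).2.1
  · have : (fun x : I => P ∧ x ≤ p) ⁻¹' {Q} = ∅ := by
      ext; simp [hP, hQ]
    rw [this]
    simp [hP, hQ]
  · have : (fun x : I => P ∧ x ≤ p) ⁻¹' {Q} = Set.univ := by
      ext; simp [hP, hQ]
    rw [this]
    simp [hP, hQ]
    rw [← ENNReal.coe_add, eq_comm, ENNReal.coe_eq_one]
    exact Subtype.ext (by simp)

/-- The standard coupling: one family of independent uniform variables, not depending on p, realises
the random sets for all p at once, increasing in p. -/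
theorem setBernoulli_eq_map_uniform {ι : Type*} (s : Set ι) (p : I) :
    setBernoulli s p = (Measure.infinitePi fun _ : ι => (volume : Measure I)).map
      fun ω => {i | i ∈ s ∧ ω i ≤ p} := by
  have h1 := Measure.infinitePi_map_pi (μ := fun _ : ι => (volume : Measure I))
    (f := fun i x => i ∈ s ∧ x ≤ p)
    fun i => (measurable_const (a := i ∈ s)).and (measurableSet_Iic (a := p)).mem
  simp_rw [map_volume_and_le_eq] at h1
  rw [setBernoulli_eq_map, ← h1, Measure.map_map]
  · rfl
  · fun_prop
  · exact measurable_pi_iff.2 fun i =>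
      (measurable_const (a := i ∈ s)).and
        ((measurableSet_Iic (a := p)).mem.comp (measurable_pi_apply i))

theorem setBernoulli_mono {ι : Type*} [Finite ι] (s : Set ι) {p q : I} (hpq : p ≤ q)
    {A : Set (Set ι)} (hA : IsUpperSet A) : setBernoulli s p A ≤ setBernoulli s q A := by
  have hm : ∀ p : I, Measurable fun (ω : ι → I) => {i | i ∈ s ∧ ω i ≤ p} := fun p => by
    refine measurable_set_iff.2 fun i =>
      (measurable_const (a := i ∈ s)).and
        ((measurableSet_Iic (a := p)).mem.comp (measurable_pi_apply i))
  have hAm : MeasurableSet A := .of_discrete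
  rw [setBernoulli_eq_map_uniform, setBernoulli_eq_map_uniform, Measure.map_apply (hm p) hAm,
    Measure.map_apply (hm q) hAm]
  exact measure_mono fun ω hω => hA (fun i hi => ⟨hi.1, hi.2.trans hpq⟩) hω

theorem setBernoulli_real_subset {ι : Type*} [Finite ι] {s : Set ι} (p : I) (F : Finset ι)
    (hF : (F : Set ι) ⊆ s) : (setBernoulli s p).real {t | (F : Set ι) ⊆ t} = (p : ℝ) ^ F.card := by
  rw [measureReal_def, setBernoulli_apply']
  have : (fun f : ι → Prop => {i | f i}) ⁻¹' {t | (F : Set ι) ⊆ t} =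
      Set.pi (F : Set ι) fun _ => {True} := by
    ext f
    simp [Set.subset_def, Set.mem_pi]
  rw [this, Measure.infinitePi_pi _ (fun _ _ => by trivial), Finset.prod_congr rfl
    (g := fun _ => (toNNReal p : ENNReal))]
  · simp
  · intro i hi
    simp [show i ∈ s from hF hi]

theorem setBernoulli_real_disjoint {ι : Type*} [Finite ι] {s : Set ι} (p : I) (F : Finset ι)
    (hF : (F : Set ι) ⊆ s) :
    (setBernoulli s p).real {t | ∀ i ∈ F, i ∉ t} = (1 - (p : ℝ)) ^ F.card := by
  rw [measureReal_def, setBernoulli_apply']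
  have : (fun f : ι → Prop => {i | f i}) ⁻¹' {t | ∀ i ∈ F, i ∉ t} =
      Set.pi (F : Set ι) fun _ => {False} := by
    ext f
    simp [Set.mem_pi]
  rw [this, Measure.infinitePi_pi _ (fun _ _ => by trivial), Finset.prod_congr rfl
    (g := fun _ => (toNNReal (σ p) : ENNReal))]
  · simp
  · intro i hi
    simp [show i ∈ s from hF hi]

namespace SimpleGraph

theorem binomialRandom_apply_preimage {V : Type*} [Finite V] (p : I)
    (A : Set (SimpleGraph V)) :
    binomialRandom V p A = setBernoulli Sym2.diagSetᶜ p (fromEdgeSet ⁻¹' A) := by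
  -- Every set of graphs is measurable, being the preimage of its image under the injective map
  -- `edgeSet` into a discrete space.
  have hA : MeasurableSet A := by
    rw [← Set.preimage_image_eq A edgeSet_injective]
    exact measurable_edgeSet .of_discrete
  rw [binomialRandom_eq_map, Measure.map_apply measurable_fromEdgeSet hA]

theorem binomialRandom_mono {V : Type*} [Finite V] {p q : I} (hpq : p ≤ q)
    {A : Set (SimpleGraph V)} (hA : IsUpperSet A) :
    binomialRandom V p A ≤ binomialRandom V q A := by
  rw [binomialRandom_apply_preimage, binomialRandom_apply_preimage]
  exact setBernoulli_mono _ hpq fun s t hst hs => hA (fromEdgeSet_mono hst) hs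

theorem binomialRandom_real_subset {V : Type*} [Finite V] (p : I) (F : Finset (Sym2 V))
    (hF : ∀ z ∈ F, ¬ z.IsDiag) :
    (binomialRandom V p).real {H | ∀ z ∈ F, z ∈ H.edgeSet} = (p : ℝ) ^ F.card := by
  rw [← setBernoulli_real_subset (s := Sym2.diagSetᶜ) p F (fun z hz => hF z hz), measureReal_def,
    measureReal_def, binomialRandom_apply_preimage]
  congr 2
  ext t
  simp +contextual [Set.subset_def, hF]

theorem binomialRandom_real_disjoint {V : Type*} [Finite V] (p : I) (F : Finset (Sym2 V))
    (hF : ∀ z ∈ F, ¬ z.IsDiag) :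
    (binomialRandom V p).real {H | ∀ z ∈ F, z ∉ H.edgeSet} = (1 - (p : ℝ)) ^ F.card := by
  rw [← setBernoulli_real_disjoint (s := Sym2.diagSetᶜ) p F (fun z hz => hF z hz), measureReal_def,
    measureReal_def, binomialRandom_apply_preimage]
  congr 2
  ext t
  simp +contextual [hF]
end SimpleGraph

end Bernoulli

/-! ### Exponential estimates for the union bounds -/

/-- Since m ≥ 2, there are at least m²/4 ≥ (δn)²/4 pairs; the constant 8/δ² makes p times this equal
to 2n. -/
theorem one_sub_div_pow_choose_le {n δ : ℝ} (hn : 0 < n) (hδ : 0 < δ) (hδn : 2 ≤ δ * n) (m : ℕ)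
    (hm : δ * n ≤ m) {p : ℝ} (hp1 : p ≤ 1) (hp : p = 8 / δ ^ 2 / n) :
    (1 - p) ^ m.choose 2 ≤ Real.exp (-(2 * n)) := by
  have h1 : (1 - p) ^ m.choose 2 ≤ Real.exp (-p) ^ m.choose 2 :=
    pow_le_pow_left₀ (by linarith) (Real.one_sub_le_exp_neg p) _
  refine h1.trans ?_
  rw [← Real.exp_nat_mul, Real.exp_le_exp, Nat.cast_choose_two]
  have h2 : (m : ℝ) ^ 2 / 4 ≤ m * (m - 1) / 2 := by nlinarith
  have h3 : (δ * n) ^ 2 ≤ (m : ℝ) ^ 2 := pow_le_pow_left₀ (by linarith) hm 2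
  have hp0 : 0 ≤ p := by rw [hp]; positivity
  have h4 : (δ * n) ^ 2 / 4 * p = 2 * n := by
    rw [hp]
    field_simp
    norm_num
  nlinarith

/-- The binomial coefficient is at most N^k/k!. In the bound on Np, the factor exp(-1) cancels
k^k/k! ≤ exp(k), and exp(-2/c), taken k ≥ cn times, gives exp(-2n). -/
theorem choose_mul_pow_le {N k : ℕ} {p n c : ℝ} (hc : 0 < c) (hp : 0 ≤ p)
    (hk : c * n ≤ k) (hN : N * p ≤ Real.exp (-(2 / c) - 1) * k) :
    (N.choose k : ℝ) * p ^ k ≤ Real.exp (-(2 * n)) := by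
  have h1 : (N.choose k : ℝ) * p ^ k ≤ (N * p) ^ k / k.factorial := by
    rw [mul_pow, mul_div_right_comm]
    exact mul_le_mul_of_nonneg_right (Nat.choose_le_pow_div k N) (by positivity)
  have h2 : (N * p) ^ k / k.factorial ≤
      Real.exp (-(2 / c) - 1) ^ k * ((k : ℝ) ^ k / k.factorial) := by
    rw [← mul_div_assoc, ← mul_pow]
    gcongr
  have h3 : (k : ℝ) ^ k / k.factorial ≤ Real.exp k :=
    Real.pow_div_factorial_le_exp _ (by positivity) _
  refine (h1.trans h2).trans ((mul_le_mul_of_nonneg_left h3 (by positivity)).trans ?_)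
  rw [← Real.exp_nat_mul, ← Real.exp_add, Real.exp_le_exp]
  have h4 : n ≤ k / c := by rwa [le_div_iff₀ hc, mul_comm]
  have h5 : (k : ℝ) * (-(2 / c) - 1) + k = -(2 * (k / c)) := by ring
  linarith

theorem two_pow_mul_exp_le (n : ℕ) :
    (2 : ℝ) ^ n * Real.exp (-(2 * (n : ℝ))) ≤ Real.exp (-(n : ℝ)) := by
  have h1 : (2 : ℝ) ^ n ≤ Real.exp 1 ^ n :=
    pow_le_pow_left₀ (by norm_num) (by linarith [Real.add_one_le_exp 1]) n
  refine (mul_le_mul_of_nonneg_right h1 (by positivity)).trans_eq ?_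
  rw [← Real.exp_nat_mul, ← Real.exp_add]
  ring_nf

/-! ### Common neighbourhoods in regular pairs -/

section Regularity

variable {α : Type u} {G : SimpleGraph α} [DecidableRel G.Adj] {A B : Finset α} {ε d : ℝ}

/-- The low-degree vertices together have density below d to Y, so they cannot form a set large
enough for the density hypothesis. -/
theorem card_low_degree_le
    (hreg : ∀ X Y : Finset α, X ⊆ A → Y ⊆ B →
      ε * (A.card : ℝ) ≤ (X.card : ℝ) → ε * (B.card : ℝ) ≤ (Y.card : ℝ) →
        d ≤ ((G.edgeDensity X Y : ℚ) : ℝ)) (hε : 0 < ε)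
    {Y : Finset α} (hY : Y ⊆ B) (hYc : ε * B.card ≤ Y.card) :
    ((A.filter fun a => ((Y.filter fun y => G.Adj a y).card : ℝ) < d * Y.card).card : ℝ) ≤
      ε * A.card := by
  by_contra! hlt
  set X := A.filter fun a => ((Y.filter fun y => G.Adj a y).card : ℝ) < d * Y.card with hX
  have hXpos : (0 : ℝ) < X.card := (by positivity : (0 : ℝ) ≤ ε * A.card).trans_lt hlt
  obtain ⟨a, ha⟩ := Finset.card_pos.1 (by exact_mod_cast hXpos : 0 < X.card)
  have hYpos : (0 : ℝ) < Y.card := by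
    rcases Y.eq_empty_or_nonempty with h | h
    · have := (Finset.mem_filter.1 ha).2
      simp [h] at this
    · exact_mod_cast h.card_pos
  have h1 := hreg X Y (Finset.filter_subset _ _) hY hlt.le hYc
  have h2 : ((G.edgeDensity X Y : ℚ) : ℝ) = ((G.interedges X Y).card : ℝ) / (X.card * Y.card) := by
    rw [SimpleGraph.edgeDensity_def]
    push_cast
    rfl
  have h3 : ((G.interedges X Y).card : ℝ) =
      ∑ a ∈ X, ((Y.filter fun y => G.Adj a y).card : ℝ) := by
    rw [SimpleGraph.interedges_def, Finset.card_filter, Finset.sum_product]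
    push_cast [Finset.card_filter]
    rfl
  have h4 : ∑ a ∈ X, ((Y.filter fun y => G.Adj a y).card : ℝ) < X.card * (d * Y.card) := by
    rw [← nsmul_eq_mul, ← Finset.sum_const]
    exact Finset.sum_lt_sum_of_nonempty ⟨a, ha⟩ fun a ha => (Finset.mem_filter.1 ha).2
  rw [h2, le_div_iff₀ (by positivity), h3] at h1
  linarith

variable [DecidableEq α]

/-- Pairs in `A` with few common neighbours in `Y`. -/
noncomputable def badPairs (G : SimpleGraph α) [DecidableRel G.Adj] (A Y : Finset α) (d : ℝ) :
    Finset (Finset α) :=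
  (A.powersetCard 2).filter fun e =>
    ((Y.filter fun y => ∀ a ∈ e, G.Adj a y).card : ℝ) < d ^ 2 * Y.card

/-- If a has at least d|Y| ≥ ε|B| neighbours in Y, that neighbourhood is itself large enough for the
density hypothesis, so at most ε|A| vertices b have fewer than d·d|Y| neighbours in it. The other
choices of a number at most ε|A|. -/
theorem card_badPairs_le
    (hreg : ∀ X Y : Finset α, X ⊆ A → Y ⊆ B →
      ε * (A.card : ℝ) ≤ (X.card : ℝ) → ε * (B.card : ℝ) ≤ (Y.card : ℝ) →
        d ≤ ((G.edgeDensity X Y : ℚ) : ℝ)) (hε : 0 < ε) (hd : 0 < d) (hd1 : d < 1)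
    {Y : Finset α} (hY : Y ⊆ B) (hYc : ε * B.card ≤ d * Y.card) :
    ((badPairs G A Y d).card : ℝ) ≤ 2 * ε * (A.card : ℝ) ^ 2 := by
  classical
  set low : Finset α → Finset α := fun Y =>
    A.filter fun a => ((Y.filter fun y => G.Adj a y).card : ℝ) < d * Y.card with hlow
  have hlowc : ∀ Y ⊆ B, ε * B.card ≤ Y.card → ((low Y).card : ℝ) ≤ ε * A.card :=
    fun Y hY hYc => card_low_degree_le hreg hε hY hYc
  set nb : α → Finset α := fun a => Y.filter fun y => G.Adj a y with hnb
  have hYc' : ε * B.card ≤ Y.card := hYc.trans (by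
    have : (0 : ℝ) ≤ Y.card := by positivity
    nlinarith)
  have hsub : badPairs G A Y d ⊆ (low Y ×ˢ A ∪
      (A \ low Y).biUnion fun a => {a} ×ˢ low (nb a)).image fun q : α × α => {q.1, q.2} := by
    intro e he
    obtain ⟨he1, he2⟩ := Finset.mem_filter.1 he
    obtain ⟨heA, hec⟩ := Finset.mem_powersetCard.1 he1
    obtain ⟨a, b, -, rfl⟩ := Finset.card_eq_two.1 hec
    have ha : a ∈ A := heA (by simp)
    have hb : b ∈ A := heA (by simp)
    refine Finset.mem_image.2 ⟨(a, b), ?_, rfl⟩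
    by_cases hal : a ∈ low Y
    · exact Finset.mem_union_left _ (Finset.mem_product.2 ⟨hal, hb⟩)
    · refine Finset.mem_union_right _ (Finset.mem_biUnion.2
        ⟨a, Finset.mem_sdiff.2 ⟨ha, hal⟩, Finset.mem_product.2 ⟨by simp, ?_⟩⟩)
      refine Finset.mem_filter.2 ⟨hb, ?_⟩
      have h1 : d * Y.card ≤ (nb a).card := by
        by_contra! hcon
        exact hal (Finset.mem_filter.2 ⟨ha, hcon⟩)
      have h2 : ((nb a).filter fun y => G.Adj b y) =
          Y.filter fun y => ∀ x ∈ ({a, b} : Finset α), G.Adj x y := by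
        ext y
        simp [hnb, and_assoc]
      rw [h2]
      have h3 : d * (d * Y.card) ≤ d * (nb a).card := mul_le_mul_of_nonneg_left h1 hd.le
      have h4 : d ^ 2 * Y.card = d * (d * Y.card) := by ring
      linarith
  have h1 : ((badPairs G A Y d).card : ℝ) ≤
      (low Y).card * A.card + ∑ a ∈ A \ low Y, ((low (nb a)).card : ℝ) := by
    have h2 := (Finset.card_le_card hsub).trans (Finset.card_image_le.trans
      ((Finset.card_union_le _ _).trans (Nat.add_le_add_left Finset.card_biUnion_le _)))
    simp only [Finset.card_product, Finset.card_singleton, one_mul] at h2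
    exact_mod_cast h2
  have h2 : ∑ a ∈ A \ low Y, ((low (nb a)).card : ℝ) ≤ A.card * (ε * A.card) := by
    rw [← nsmul_eq_mul, ← Finset.sum_const]
    refine (Finset.sum_le_sum fun a ha => ?_).trans (Finset.sum_le_sum_of_subset_of_nonneg
      Finset.sdiff_subset fun _ _ _ => by positivity)
    obtain ⟨haA, hal⟩ := Finset.mem_sdiff.1 ha
    refine hlowc _ ((Finset.filter_subset _ _).trans hY) (hYc.trans ?_)
    by_contra! hcon
    exact hal (Finset.mem_filter.2 ⟨haA, hcon⟩)
  have h3 := mul_le_mul_of_nonneg_right (hlowc Y hY hYc') (Nat.cast_nonneg (α := ℝ) A.card)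
  nlinarith

end Regularity

/-! ### Random graphs are rich with high probability -/

section RandomGraph

open MeasureTheory ProbabilityTheory unitInterval

variable {α : Type u} [DecidableEq α] {A : Finset α}

theorem exists_sym2_of_pair {e : Finset α} (heA : e ⊆ A) (he : e.card = 2) :
    ∃ z : Sym2 A, ¬ z.IsDiag ∧ (∀ x : A, x ∈ z ↔ (x : α) ∈ e) ∧
      ∀ H : SimpleGraph A, (H.map (Function.Embedding.subtype (· ∈ A))).IsNClique 2 e ↔
        z ∈ H.edgeSet := by
  obtain ⟨a, b, hab, rfl⟩ := Finset.card_eq_two.1 he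
  have ha : a ∈ A := heA (by simp)
  have hb : b ∈ A := heA (by simp)
  refine ⟨s(⟨a, ha⟩, ⟨b, hb⟩), by simpa using hab, fun x => by simp [Subtype.ext_iff], fun H => ?_⟩
  have h1 : (H.map (Function.Embedding.subtype (· ∈ A))).Adj a b ↔ H.Adj ⟨a, ha⟩ ⟨b, hb⟩ :=
    SimpleGraph.map_adj_apply (f := Function.Embedding.subtype (· ∈ A)) (a := ⟨a, ha⟩)
      (b := ⟨b, hb⟩)
  rw [SimpleGraph.isNClique_iff, SimpleGraph.mem_edgeSet, ← h1]
  simp [SimpleGraph.isClique_iff, hab]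

/-- Dictionary between pairs of vertices of `α` inside `A` and potential edges on the subtype; equal
cardinalities keep the exponents in the product formulas. -/
theorem exists_sym2_image (F : Finset (Finset α)) (hF : F ⊆ A.powersetCard 2) :
    ∃ F' : Finset (Sym2 A), F'.card = F.card ∧ (∀ z ∈ F', ¬ z.IsDiag) ∧
      ∀ H : SimpleGraph A,
        ((∀ e ∈ F, (H.map (Function.Embedding.subtype (· ∈ A))).IsNClique 2 e) ↔
          ∀ z ∈ F', z ∈ H.edgeSet) ∧
        ((∀ e ∈ F, ¬ (H.map (Function.Embedding.subtype (· ∈ A))).IsNClique 2 e) ↔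
          ∀ z ∈ F', z ∉ H.edgeSet) := by
  classical
  have h1 : ∀ e : F, ∃ z : Sym2 A, ¬ z.IsDiag ∧ (∀ x : A, x ∈ z ↔ (x : α) ∈ (e : Finset α)) ∧
      ∀ H : SimpleGraph A, (H.map (Function.Embedding.subtype (· ∈ A))).IsNClique 2 (e : Finset α) ↔
        z ∈ H.edgeSet := fun e =>
    exists_sym2_of_pair (Finset.mem_powersetCard.1 (hF e.2)).1
      (Finset.mem_powersetCard.1 (hF e.2)).2
  choose g hg1 hg2 hg3 using h1
  have hinj : Function.Injective g := by
    intro e f hef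
    ext x
    by_cases hx : x ∈ A
    · rw [← hg2 e ⟨x, hx⟩, ← hg2 f ⟨x, hx⟩, hef]
    · exact ⟨fun h => absurd ((Finset.mem_powersetCard.1 (hF e.2)).1 h) hx,
        fun h => absurd ((Finset.mem_powersetCard.1 (hF f.2)).1 h) hx⟩
  refine ⟨Finset.univ.image g, ?_, ?_, fun H => ⟨?_, ?_⟩⟩
  · rw [Finset.card_image_of_injective _ hinj, Finset.card_univ, Fintype.card_coe]
  · exact Finset.forall_mem_image.2 fun e _ => hg1 e
  · rw [Finset.forall_mem_image]
    exact ⟨fun h e _ => (hg3 e H).1 (h e e.2), fun h e he => (hg3 ⟨e, he⟩ H).2 (h (by simp))⟩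
  · rw [Finset.forall_mem_image]
    exact ⟨fun h e _ => mt (hg3 e H).2 (h e e.2), fun h e he => mt (hg3 ⟨e, he⟩ H).1 (h (by simp))⟩

theorem binomialRandom_real_forall_isNClique (p : I) (F : Finset (Finset α))
    (hF : F ⊆ A.powersetCard 2) :
    (SimpleGraph.binomialRandom A p).real {H | ∀ e ∈ F,
      (H.map (Function.Embedding.subtype (· ∈ A))).IsNClique 2 e} = (p : ℝ) ^ F.card := by
  obtain ⟨F', hc, hd, hH⟩ := exists_sym2_image F hF
  simp_rw [fun H => (hH H).1]
  rw [SimpleGraph.binomialRandom_real_subset p F' hd, hc]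

theorem binomialRandom_real_forall_not_isNClique (p : I) (F : Finset (Finset α))
    (hF : F ⊆ A.powersetCard 2) :
    (SimpleGraph.binomialRandom A p).real {H | ∀ e ∈ F,
      ¬ (H.map (Function.Embedding.subtype (· ∈ A))).IsNClique 2 e} = (1 - (p : ℝ)) ^ F.card := by
  obtain ⟨F', hc, hd, hH⟩ := exists_sym2_image F hF
  simp_rw [fun H => (hH H).2]
  rw [SimpleGraph.binomialRandom_real_disjoint p F' hd, hc]

variable {G : SimpleGraph α} [DecidableRel G.Adj] {B : Finset α} {ε d δ c : ℝ} {n : ℕ}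

/-- Each failure, for a fixed set S or Y, has probability at most exp(-2n), against at most 2^n
sets. `hεC` bounds the expected number of bad edges, at most 2εn²p, by a tiny multiple of cn. -/
theorem binomialRandom_real_not_isRich_le
    (hreg : ∀ X Y : Finset α, X ⊆ A → Y ⊆ B →
      ε * (A.card : ℝ) ≤ (X.card : ℝ) → ε * (B.card : ℝ) ≤ (Y.card : ℝ) →
        d ≤ ((G.edgeDensity X Y : ℚ) : ℝ)) (hε : 0 < ε) (hd : 0 < d) (hd1 : d < 1)
    (hn : 0 < n) (hA : A.card ≤ n) (hB : B.card ≤ n) (hδ : 0 < δ) (hδn : 2 ≤ δ * n) (hc : 0 < c)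
    (hεd : ε ≤ d * c) (hεC : 2 * ε * (8 / δ ^ 2) ≤ Real.exp (-(2 / c) - 1) * c)
    (p : I) (hp : (p : ℝ) = 8 / δ ^ 2 / n) :
    (SimpleGraph.binomialRandom A p).real {H | ¬ IsRich G
      (H.map (Function.Embedding.subtype (· ∈ A))) A B d (δ * n) (c * n)} ≤
        2 * Real.exp (-(n : ℝ)) := by
  classical
  have hnR : (0 : ℝ) < n := by exact_mod_cast hn
  set k := ⌈c * n⌉₊ with hk
  have hkc : c * n ≤ k := Nat.le_ceil _
  set P₁ := A.powerset.filter fun S => δ * n ≤ (S.card : ℝ)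
  set P₂ := B.powerset.filter fun Y => c * n ≤ (Y.card : ℝ)
  set μ := SimpleGraph.binomialRandom A p
  have hcov : {H : SimpleGraph A | ¬ IsRich G
      (H.map (Function.Embedding.subtype (· ∈ A))) A B d (δ * n) (c * n)} ⊆
      (⋃ S ∈ P₁, {H | ∀ e ∈ S.powersetCard 2,
        ¬ (H.map (Function.Embedding.subtype (· ∈ A))).IsNClique 2 e}) ∪
      ⋃ Y ∈ P₂, ⋃ F ∈ (badPairs G A Y d).powersetCard k, {H | ∀ e ∈ F,
        (H.map (Function.Embedding.subtype (· ∈ A))).IsNClique 2 e} := by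
    intro H hH
    by_contra hcon
    simp only [Set.mem_union, Set.mem_iUnion, not_or, not_exists, Set.mem_ofPred_eq] at hcon
    refine hH ⟨fun S hS hSc => ?_, fun Y hY hYc F hF => ?_⟩
    · have h1 := hcon.1 S (Finset.mem_filter.2 ⟨Finset.mem_powerset.2 hS, hSc⟩)
      push Not at h1
      obtain ⟨e, he, heH⟩ := h1
      exact ⟨e, (Finset.mem_powersetCard.1 he).1, heH⟩
    · by_contra! hge
      have hkF : k ≤ F.card := Nat.ceil_le.2 hge
      -- Only families of exactly k = ⌈cn⌉ bad pairs enter the union bound, so that each has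
      -- probability p^k.
      obtain ⟨F', hF', hc'⟩ := Finset.exists_subset_card_eq hkF
      refine hcon.2 Y (Finset.mem_filter.2 ⟨Finset.mem_powerset.2 hY, hYc⟩) F'
        (Finset.mem_powersetCard.2 ⟨fun e he => ?_, hc'⟩) fun e he => (hF e (hF' he)).2.1
      obtain ⟨h1, h2, h3⟩ := hF e (hF' he)
      exact Finset.mem_filter.2 ⟨Finset.mem_powersetCard.2 ⟨h1, h2.card_eq⟩, h3⟩
  have hbound₁ : ∀ S ∈ P₁, μ.real {H | ∀ e ∈ S.powersetCard 2,
      ¬ (H.map (Function.Embedding.subtype (· ∈ A))).IsNClique 2 e} ≤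
        Real.exp (-(2 * (n : ℝ))) := by
    intro S hS
    obtain ⟨hSA, hSc⟩ := Finset.mem_filter.1 hS
    rw [binomialRandom_real_forall_not_isNClique p _
      (Finset.powersetCard_mono (Finset.mem_powerset.1 hSA)), Finset.card_powersetCard]
    exact one_sub_div_pow_choose_le hnR hδ hδn _ hSc p.2.2 hp
  have hbound₂ : ∀ Y ∈ P₂, μ.real (⋃ F ∈ (badPairs G A Y d).powersetCard k, {H | ∀ e ∈ F,
      (H.map (Function.Embedding.subtype (· ∈ A))).IsNClique 2 e}) ≤
        Real.exp (-(2 * (n : ℝ))) := by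
    intro Y hY
    obtain ⟨hYB, hYc⟩ := Finset.mem_filter.1 hY
    have hbad := card_badPairs_le hreg hε hd hd1 (Finset.mem_powerset.1 hYB) (by
      have h1 : ε * B.card ≤ d * c * n :=
        mul_le_mul hεd (by exact_mod_cast hB) (by positivity) (by positivity)
      have h2 : d * (c * n) ≤ d * Y.card := mul_le_mul_of_nonneg_left hYc hd.le
      linarith)
    refine (measureReal_biUnion_finset_le _ _).trans ?_
    rw [Finset.sum_congr rfl (g := fun _ => (p : ℝ) ^ k)]
    · rw [Finset.sum_const, Finset.card_powersetCard, nsmul_eq_mul]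
      refine choose_mul_pow_le hc p.2.1 hkc ?_
      have h1 : ((badPairs G A Y d).card : ℝ) ≤ 2 * ε * (n : ℝ) ^ 2 := hbad.trans (by
        gcongr)
      calc ((badPairs G A Y d).card : ℝ) * p ≤ 2 * ε * (n : ℝ) ^ 2 * p :=
            mul_le_mul_of_nonneg_right h1 p.2.1
        _ = 2 * ε * (8 / δ ^ 2) * n := by rw [hp]; field_simp
        _ ≤ Real.exp (-(2 / c) - 1) * c * n := mul_le_mul_of_nonneg_right hεC hnR.le
        _ ≤ Real.exp (-(2 / c) - 1) * k := by
            rw [mul_assoc]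
            exact mul_le_mul_of_nonneg_left hkc (by positivity)
    · intro F hF
      obtain ⟨hF1, hF2⟩ := Finset.mem_powersetCard.1 hF
      rw [binomialRandom_real_forall_isNClique p F (hF1.trans (Finset.filter_subset _ _)), hF2]
  have hcard₁ : (P₁.card : ℝ) ≤ 2 ^ n := by
    have : P₁.card ≤ 2 ^ n := (Finset.card_filter_le _ _).trans (by
      rw [Finset.card_powerset]
      exact Nat.pow_le_pow_right (by norm_num) hA)
    exact_mod_cast this
  have hcard₂ : (P₂.card : ℝ) ≤ 2 ^ n := by
    have : P₂.card ≤ 2 ^ n := (Finset.card_filter_le _ _).trans (by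
      rw [Finset.card_powerset]
      exact Nat.pow_le_pow_right (by norm_num) hB)
    exact_mod_cast this
  have hsum : ∀ {P : Finset (Finset α)} {f : Finset α → Set (SimpleGraph A)},
      (P.card : ℝ) ≤ 2 ^ n → (∀ S ∈ P, μ.real (f S) ≤ Real.exp (-(2 * (n : ℝ)))) →
      μ.real (⋃ S ∈ P, f S) ≤ Real.exp (-(n : ℝ)) := by
    intro P f hP hf
    refine (measureReal_biUnion_finset_le _ _).trans ((Finset.sum_le_sum hf).trans ?_)
    rw [Finset.sum_const, nsmul_eq_mul]
    exact (mul_le_mul_of_nonneg_right hP (by positivity)).trans (two_pow_mul_exp_le n)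
  refine (measureReal_mono hcov).trans ((measureReal_union_le _ _).trans ?_)
  linarith [hsum hcard₁ hbound₁, hsum hcard₂ hbound₂]

/-- Richness is not monotone, since extra edges may be bad. Containing a rich subgraph is monotone
and suffices for tiling, so the estimate at the smallest p transfers to all larger p. -/
theorem one_sub_le_binomialRandom_real_exists_isRich
    (hreg : ∀ X Y : Finset α, X ⊆ A → Y ⊆ B →
      ε * (A.card : ℝ) ≤ (X.card : ℝ) → ε * (B.card : ℝ) ≤ (Y.card : ℝ) →
        d ≤ ((G.edgeDensity X Y : ℚ) : ℝ)) (hε : 0 < ε) (hd : 0 < d) (hd1 : d < 1)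
    (hn : 0 < n) (hA : A.card ≤ n) (hB : B.card ≤ n) (hδ : 0 < δ) (hδn : 2 ≤ δ * n) (hc : 0 < c)
    (hεd : ε ≤ d * c) (hεC : 2 * ε * (8 / δ ^ 2) ≤ Real.exp (-(2 / c) - 1) * c)
    (p : I) (hp : 8 / δ ^ 2 / n ≤ (p : ℝ)) :
    1 - 2 * Real.exp (-(n : ℝ)) ≤ (SimpleGraph.binomialRandom A p).real {H | ∃ Γ ≤ H, IsRich G
      (Γ.map (Function.Embedding.subtype (· ∈ A))) A B d (δ * n) (c * n)} := by
  set p₀ : I := ⟨8 / δ ^ 2 / n, by positivity, hp.trans p.2.2⟩ with hp₀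
  have h1 := binomialRandom_real_not_isRich_le hreg hε hd hd1 hn hA hB hδ hδn hc hεd hεC p₀ rfl
  set R : Set (SimpleGraph A) := {H | IsRich G
      (H.map (Function.Embedding.subtype (· ∈ A))) A B d (δ * n) (c * n)} with hR
  have h2 : 1 ≤ (SimpleGraph.binomialRandom A p₀).real R +
      (SimpleGraph.binomialRandom A p₀).real Rᶜ := by
    refine le_trans ?_ (measureReal_union_le _ _)
    simp
  have h3 : (SimpleGraph.binomialRandom A p₀).real R ≤
      (SimpleGraph.binomialRandom A p₀).real {H | ∃ Γ ≤ H, IsRich G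
      (Γ.map (Function.Embedding.subtype (· ∈ A))) A B d (δ * n) (c * n)} :=
    measureReal_mono fun H hH => ⟨H, le_rfl, hH⟩
  have h4 : (SimpleGraph.binomialRandom A p₀).real {H | ∃ Γ ≤ H, IsRich G
      (Γ.map (Function.Embedding.subtype (· ∈ A))) A B d (δ * n) (c * n)} ≤
      (SimpleGraph.binomialRandom A p).real {H | ∃ Γ ≤ H, IsRich G
      (Γ.map (Function.Embedding.subtype (· ∈ A))) A B d (δ * n) (c * n)} :=
    ENNReal.toReal_mono (measure_ne_top _ _)
      (SimpleGraph.binomialRandom_mono (Subtype.coe_le_coe.1 hp)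
      fun H H' hle ⟨Γ, hΓ, hr⟩ => ⟨Γ, hΓ.trans hle, hr⟩)
  have h5 : (SimpleGraph.binomialRandom A p₀).real Rᶜ ≤ 2 * Real.exp (-(n : ℝ)) := h1
  linarith

end RandomGraph

/-! ### The main theorem -/

theorem mainTheorem8 (d : ℝ) (hd_pos : 0 < d) (hd_lt_one : d < 1) :
    ∃ ε : ℝ, 0 < ε ∧ ∃ C : ℝ, 0 < C ∧
      ∀ η : ℝ, 0 < η → ∃ N : ℕ, ∀ n : ℕ, N ≤ n →
        ∀ (α : Type u) [DecidableEq α] (G : SimpleGraph α) [DecidableRel G.Adj]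
          (U V : Finset α) (p : unitInterval),
          Disjoint U V →
          V.card = n →
          3 * (n : ℝ) / 4 ≤ (U.card : ℝ) →
          U.card ≤ n →
          3 ∣ U.card + V.card →
          IsSuperRegularPair G U V ε d →
          C / (n : ℝ) ≤ (p : ℝ) →
          1 - η ≤ ((SimpleGraph.binomialRandom U p).prod (SimpleGraph.binomialRandom V p)).real
            {H : SimpleGraph U × SimpleGraph V |
              HasTriangleFactorOn (perturbedGraph G H.1 H.2) (U ∪ V)} := by
  set δ := d / 10 with hδ
  set c := d ^ 2 / 200 with hc
  have hδ0 : 0 < δ := by positivity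
  have hc0 : 0 < c := by positivity
  set C := 8 / δ ^ 2 with hC
  have hC0 : 0 < C := by positivity
  -- ε is chosen after C: the first term keeps neighbourhoods of size d·cn above the regularity
  -- threshold, the second makes bad edges rare at density C/n.
  set ε := min (d * c) (Real.exp (-(2 / c) - 1) * c / (2 * C)) with hεdef
  have hε0 : 0 < ε := lt_min (by positivity) (by positivity)
  have hεd : ε ≤ d * c := min_le_left _ _
  have hεC : 2 * ε * C ≤ Real.exp (-(2 / c) - 1) * c := by
    have h := min_le_right (d * c) (Real.exp (-(2 / c) - 1) * c / (2 * C))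
    rw [← hεdef, le_div_iff₀ (by positivity)] at h
    linarith
  refine ⟨ε, hε0, C, hC0, fun η hη => ?_⟩
  have hev : ∀ᶠ n : ℕ in Filter.atTop, 0 < n ∧ 2 ≤ δ * n ∧ 1 ≤ c * n ∧
      4 * Real.exp (-(n : ℝ)) ≤ η := by
    have hcast := tendsto_natCast_atTop_atTop (R := ℝ)
    refine (Filter.eventually_gt_atTop 0).and
      (((hcast.const_mul_atTop hδ0).eventually_ge_atTop 2).and
      (((hcast.const_mul_atTop hc0).eventually_ge_atTop 1).and ?_))
    have h := (Real.tendsto_exp_neg_atTop_nhds_zero.comp hcast).const_mul 4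
    rw [mul_zero] at h
    exact (h.eventually (gt_mem_nhds hη)).mono fun n hn => le_of_lt hn
  obtain ⟨N, hN⟩ := Filter.eventually_atTop.1 hev
  refine ⟨N, fun n hn α _ G _ U V p hUV hVn hU hUn hdvd hreg hp => ?_⟩
  obtain ⟨hn0, hδn, hcn, hexp⟩ := hN n hn
  have h1 := one_sub_le_binomialRandom_real_exists_isRich hreg.density hε0 hd_pos hd_lt_one hn0 hUn
    hVn.le hδ0 hδn hc0 hεd hεC p hp
  have h2 := one_sub_le_binomialRandom_real_exists_isRich (G := G) (A := V) (B := U)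
    (fun X Y hX hY hXc hYc => by
      rw [SimpleGraph.edgeDensity_comm]
      exact hreg.density Y X hY hX hYc hXc) hε0 hd_pos hd_lt_one hn0 hVn.le hUn hδ0 hδn hc0 hεd hεC
    p hp
  set R₁ : Set (SimpleGraph U) := {H | ∃ Γ ≤ H, IsRich G
      (Γ.map (Function.Embedding.subtype (· ∈ U))) U V d (δ * n) (c * n)}
  set R₂ : Set (SimpleGraph V) := {H | ∃ Γ ≤ H, IsRich G
      (Γ.map (Function.Embedding.subtype (· ∈ V))) V U d (δ * n) (c * n)}
  have hsub : R₁ ×ˢ R₂ ⊆ {H : SimpleGraph U × SimpleGraph V |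
      HasTriangleFactorOn (perturbedGraph G H.1 H.2) (U ∪ V)} := by
    rintro ⟨H₁, H₂⟩ ⟨⟨Γ₁, hΓ₁, hr₁⟩, Γ₂, hΓ₂, hr₂⟩
    refine (hasTriangleTiling_of_isRich (n := n) (t := c * n) hd_pos hd_lt_one
      (le_sup_left.trans le_sup_left)
      ((SimpleGraph.map_monotone _ hΓ₁).trans (le_sup_right.trans le_sup_left))
      ((SimpleGraph.map_monotone _ hΓ₂).trans le_sup_right) hUV (by exact_mod_cast hVn) hU
      (by exact_mod_cast hUn) hdvd rfl hcn hr₁ hr₂ hreg.degree_left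
      hreg.degree_right).hasTriangleFactorOn
  refine le_trans ?_ (MeasureTheory.measureReal_mono hsub)
  rw [MeasureTheory.measureReal_prod_prod]
  have hx := Real.exp_pos (-(n : ℝ))
  have hle₁ : (SimpleGraph.binomialRandom U p).real R₁ ≤ 1 := MeasureTheory.measureReal_le_one
  have hle₂ : (SimpleGraph.binomialRandom V p).real R₂ ≤ 1 := MeasureTheory.measureReal_le_one
  -- From (1 - a)(1 - b) ≥ 0 follows ab ≥ a + b - 1 ≥ 1 - 4exp(-n) ≥ 1 - η.
  nlinarith [mul_nonneg (sub_nonneg.2 hle₁) (sub_nonneg.2 hle₂)]
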